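/- Let $\mathbb F_2$ be the free group on two generators $a,b$, and let $\ell(w)$ denote the word length of $w\in\mathbb F_2$ with respect to $\{a,a^{-1},b,b^{-1}\}$. For a subgroup $\Lambda\subset\mathbb F_2$ put $$\operatorname{girth}(\Lambda):=\min\{\ell(w)\mid w\in\Lambda\setminus\{e\}\}\in\mathbb N\cup\{\infty\},$$ where $\min\varnothing=\infty$. If $\Lambda$ is a normal subgroup of $\mathbb F_2$, then $$\operatorname{girth}([\Lambda,\Lambda])\ \ge\ 3\cdot\operatorname{girth}(\Lambda),$$ where $[\Lambda,\Lambda]$ is the commutator subgroup of $\Lambda$. -/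

import Mathlib

/-- The girth of a subgroup `Λ` of the free group `𝔽₂` on two generators: the least word length
(with respect to the generators and their inverses) of a nontrivial element of `Λ`.
It takes values in `ℕ∞`; since `ℕ∞` is well-ordered the infimum is attained when `Λ` is
nontrivial, and it is `⊤` (the minimum of the empty set) when `Λ` is trivial. -/
noncomputable def freeGirth (Λ : Subgroup (FreeGroup (Fin 2))) : ℕ∞ :=
  sInf ((fun w : FreeGroup (Fin 2) => (w.norm : ℕ∞)) '' ((Λ : Set (FreeGroup (Fin 2))) \ {1}))

/-!
The elements of `⁅Λ, Λ⁆` are the closed walks in the Cayley graph of `F ⧸ Λ` that cross every edge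
equally often in both directions. One half of this suffices: for a fixed edge, the free group acts
on `(F ⧸ Λ) × ℤ` by moving the first coordinate along the Cayley graph and counting the signed
crossings of that edge in the second one. The elements of `Λ` act by translating each fibre `{q} ×
ℤ`, so they commute and their commutators act trivially (`commutator_le_ker_crossingHom`).

Since `⁅Λ, Λ⁆` is normal, a shortest nontrivial element may be taken cyclically reduced, say of
length `n`; repeating it gives an infinite periodic walk without backtracking. Every edge the walk
uses is crossed in both directions within a period (`exists_edge_eq_of_mem_commutator`), so `n` is
at least twice the number of edges used, and `2 * t ≤ n` follows once `t` consecutive edges of the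
walk are distinct.

Let `L` be the length of a shortest closed subwalk. The walk cannot go round one shortest cycle
forever, since it would then cross the edges of that cycle in one direction only. Hence at some time
`k + L` it has just gone round such a cycle and takes another edge than at time `k`. Let `k + t` be
the next time it meets a vertex visited since time `k`, the one of time `k + u`. The `t` edges
crossed since time `k` are distinct (`edge_ne_edge`) and form a theta graph (`u < L`, degenerating
to two cycles with a common vertex if `u = 0`) or two cycles joined by a path (`L ≤ u`). If `g` is
the girth, then a theta graph has three closed walks, of lengths `L`, `t - u` and `t - L + u`, and
their sum `2 * t` is at least `3 * g`; in the other case `t ≥ 2 * g`.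
-/

namespace FreeGroup

open MulOpposite

variable {α : Type*}

/-! ### Subwords of an infinite sequence of letters -/

/-- The product of the first `k` letters of a sequence, as an element of the free group. -/
def prefixProd (x : ℕ → α × Bool) (k : ℕ) : FreeGroup α := mk ((List.range k).map x)

variable {x : ℕ → α × Bool}

lemma prefixProd_succ (x : ℕ → α × Bool) (k : ℕ) :
    prefixProd x (k + 1) = prefixProd x k * mk [x k] := by
  simp [prefixProd, List.range_succ]

lemma prefixProd_add (x : ℕ → α × Bool) (i d : ℕ) :
    prefixProd x (i + d) = prefixProd x i * mk ((List.range' i d).map x) := by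
  have h := List.range'_append_1 (s := 0) (m := i) (n := d)
  rw [zero_add] at h
  rw [prefixProd, prefixProd, mul_mk, ← List.map_append, List.range_eq_range',
    List.range_eq_range', h]

lemma isReduced_map_range' (hx : ∀ i, (x i).1 = (x (i + 1)).1 → (x i).2 = (x (i + 1)).2)
    (i d : ℕ) : IsReduced ((List.range' i d).map x) := by
  rw [IsReduced, List.isChain_iff_getElem]
  intro j hj
  simpa [add_assoc] using hx (i + j)

lemma IsReduced.norm_mk [DecidableEq α] {l : List (α × Bool)} (hl : IsReduced l) :
    norm (mk l) = l.length := by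
  rw [norm, toWord_mk, hl.reduce_eq]

lemma IsReduced.mk_injOn {l l' : List (α × Bool)} (hl : IsReduced l) (hl' : IsReduced l')
    (h : mk l = mk l') : l = l' := by
  classical
  rw [← hl.reduce_eq, ← hl'.reduce_eq, reduce.sound h]

/-- A periodic repetition of a cyclically reduced word never backtracks. -/
lemma IsCyclicallyReduced.exists_periodic {l : List (α × Bool)} (hl : IsCyclicallyReduced l)
    (hne : l ≠ []) :
    ∃ x : ℕ → α × Bool, (∀ i, x (i + l.length) = x i) ∧
      (∀ i, (x i).1 = (x (i + 1)).1 → (x i).2 = (x (i + 1)).2) ∧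
      prefixProd x l.length = mk l := by
  have hpos : 0 < l.length := List.length_pos_iff.2 hne
  refine ⟨fun i => l[i % l.length]'(Nat.mod_lt _ hpos), fun i => by simp, fun i => ?_, ?_⟩
  · have hi := Nat.mod_lt i hpos
    obtain ⟨hr, hc⟩ := hl
    rw [IsReduced, List.isChain_iff_getElem] at hr
    rcases Nat.lt_or_ge (i % l.length + 1) l.length with h | h
    · have : (i + 1) % l.length = i % l.length + 1 := by
        rw [Nat.add_mod, Nat.mod_eq_of_lt (a := 1) (by omega), Nat.mod_eq_of_lt h]
      simpa [this] using hr (i % l.length) h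
    · have h1 : i % l.length = l.length - 1 := by omega
      have h2 : (i + 1) % l.length = 0 := by
        rw [← Nat.mod_add_mod, h1, Nat.sub_add_cancel hpos, Nat.mod_self]
      have := hc (l[l.length - 1]) (by simp [List.getLast?_eq_getElem?])
        (l[0]) (by simp [List.head?_eq_getElem?])
      simpa [h1, h2] using this
  · unfold prefixProd
    congr 1
    refine List.ext_getElem (by simp) fun i h1 h2 => ?_
    simp [Nat.mod_eq_of_lt h2]

/-! ### Signed crossings of an edge of the Cayley graph -/

section Crossing

variable {Q : Type*} [Group Q] [DecidableEq α] [DecidableEq Q]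

/-- The permutation of `Q × ℤ` that moves the first coordinate along the edge labelled `b` of the
Cayley graph and raises the second one by `1` if that edge is `e`. The edge labelled `b` from `q`
to `q * s b` is encoded as `(b, q)`. -/
def crossingPerm (s : α → Q) (e : α × Q) (b : α) : Equiv.Perm (Q × ℤ) where
  toFun p := (p.1 * s b, p.2 + if (b, p.1) = e then 1 else 0)
  invFun p := (p.1 * (s b)⁻¹, p.2 - if (b, p.1 * (s b)⁻¹) = e then 1 else 0)
  left_inv p := by simp
  right_inv p := by simp

/-- The action of the free group on `Q × ℤ` in which a word walks through the Cayley graph and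
counts its signed crossings of `e`. The opposite group makes the leftmost letter act first. -/
def crossingHom (s : α → Q) (e : α × Q) : FreeGroup α →* (Equiv.Perm (Q × ℤ))ᵐᵒᵖ :=
  lift fun b => op (crossingPerm s e b)

lemma exists_crossingHom_apply (s : α → Q) (e : α × Q) (w : FreeGroup α) :
    ∃ c : Q → ℤ, ∀ q m, unop (crossingHom s e w) (q, m) = (q * lift s w, m + c q) := by
  induction w using FreeGroup.induction_on with
  | C1 => exact ⟨0, by simp⟩
  | of b => exact ⟨fun q => if (b, q) = e then 1 else 0, by simp [crossingHom, crossingPerm]⟩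
  | inv_of b _ =>
    refine ⟨fun q => - if (b, q * (s b)⁻¹) = e then 1 else 0, fun q m => ?_⟩
    have h1 : crossingHom s e (of b)⁻¹ = op (crossingPerm s e b)⁻¹ := by
      rw [_root_.map_inv]
      simp [crossingHom]
    have h2 : lift s (of b)⁻¹ = (s b)⁻¹ := by rw [_root_.map_inv, lift_apply_of]
    rw [h1, h2]
    exact congrArg (Prod.mk (q * (s b)⁻¹)) (sub_eq_add_neg _ _)
  | mul y z hy hz =>
    obtain ⟨c, hc⟩ := hy
    obtain ⟨d, hd⟩ := hz
    exact ⟨fun q => c q + d (q * lift s y), fun q m => by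
      simp [hc, hd, mul_assoc, add_assoc]⟩

/-- Elements trivial in `Q` translate each fibre `{q} × ℤ`, and such translations commute. -/
lemma commutator_le_ker_crossingHom (s : α → Q) (e : α × Q) :
    ⁅(lift s).ker, (lift s).ker⁆ ≤ (crossingHom s e).ker := by
  rw [Subgroup.commutator_le]
  intro y hy z hz
  obtain ⟨c, hc⟩ := exists_crossingHom_apply s e y
  obtain ⟨d, hd⟩ := exists_crossingHom_apply s e z
  rw [MonoidHom.mem_ker] at hy hz ⊢
  rw [map_commutatorElement, commutatorElement_eq_one_iff_mul_comm]
  apply unop_injective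
  ext1 ⟨q, m⟩
  simp [hc, hd, hy, hz, add_right_comm]

end Crossing

/-! ### Walks in the Cayley graph -/

section Walk

variable {Q : Type*} [Group Q] {s : α → Q}

/-- The vertex of the Cayley graph reached after `k` letters. -/
def vertex (s : α → Q) (x : ℕ → α × Bool) (k : ℕ) : Q := lift s (prefixProd x k)

/-- The unoriented edge crossed by the letter at position `k`, encoded by its label and the vertex
where it starts when its label is read positively. -/
def edge (s : α → Q) (x : ℕ → α × Bool) (k : ℕ) : α × Q :=
  ((x k).1, if (x k).2 then vertex s x k else vertex s x (k + 1))

lemma vertex_succ (s : α → Q) (x : ℕ → α × Bool) (k : ℕ) :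
    vertex s x (k + 1) = vertex s x k * lift s (mk [x k]) := by
  rw [vertex, vertex, prefixProd_succ, _root_.map_mul]

lemma vertex_eq_iff {i d : ℕ} :
    vertex s x i = vertex s x (i + d) ↔ mk ((List.range' i d).map x) ∈ (lift s).ker := by
  rw [vertex, vertex, prefixProd_add, _root_.map_mul, MonoidHom.mem_ker, eq_comm, mul_eq_left]

/-- The same unoriented edge is crossed either by the same letter from the same vertex, or in
opposite directions with the endpoints exchanged. -/
lemma edge_ne_of_endpoints {a b : ℕ} (hv : vertex s x a = vertex s x b → x a ≠ x b)
    (hback : vertex s x a = vertex s x (b + 1) → vertex s x (a + 1) ≠ vertex s x b) :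
    edge s x a ≠ edge s x b := by
  intro h
  have ha := vertex_succ s x a
  have hb := vertex_succ s x b
  unfold edge at h
  generalize hxa : x a = p at *
  generalize hxb : x b = q at *
  obtain ⟨c, i⟩ := p
  obtain ⟨c', j⟩ := q
  obtain ⟨rfl, h2⟩ := Prod.ext_iff.1 h
  cases i <;> cases j <;> simp at h2 ha hb hv hback
  · exact hv (by rw [ha, hb] at h2; exact mul_right_cancel h2)
  · exact hback (by rw [hb, ← h2, ha]; simp) h2
  · exact hback h2 (by rw [ha, h2, hb]; simp)
  · exact hv h2

/-- A stretch of a walk without backtracking crosses distinct edges if its vertices are distinct,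
except that the initial one may be revisited as long as it is then left by another edge. -/
lemma edge_ne_edge (hx : ∀ i, (x i).1 = (x (i + 1)).1 → (x i).2 = (x (i + 1)).2) {k m : ℕ}
    (H : ∀ a b, k ≤ a → a < b → b < m → vertex s x a = vertex s x b → a = k ∧ x a ≠ x b)
    {a b : ℕ} (hka : k ≤ a) (hab : a < b) (hbm : b < m) : edge s x a ≠ edge s x b := by
  intro he
  by_cases hb : b = a + 1
  · subst hb
    -- Consecutive letters with the same label are equal, so the edge was crossed the same way.
    have hl : (x a).1 = (x (a + 1)).1 := (Prod.ext_iff.1 he).1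
    have hxe : x a = x (a + 1) := Prod.ext hl (hx a hl)
    have hv : vertex s x a = vertex s x (a + 1) := by
      have h2 := congrArg Prod.snd he
      simp only [edge, ← hxe] at h2
      split_ifs at h2
      · exact h2
      · rw [vertex_succ s x (a + 1), ← hxe, vertex_succ s x a] at h2
        rw [vertex_succ s x a]
        exact mul_right_cancel h2
    exact (H a (a + 1) hka hab hbm hv).2 hxe
  · refine edge_ne_of_endpoints (fun h => (H a b hka hab hbm h).2) (fun _ h => ?_) he
    have := (H (a + 1) b (by omega) (by omega) hbm h).1
    omega

lemma vertex_periodic {n k : ℕ} (hv : vertex s x (k + n) = vertex s x k)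
    (hx : ∀ d, vertex s x (k + d + n) = vertex s x (k + d) → x (k + d + n) = x (k + d)) (d : ℕ) :
    vertex s x (k + d + n) = vertex s x (k + d) := by
  induction d with
  | zero => exact hv
  | succ d ih =>
    rw [show k + (d + 1) + n = k + d + n + 1 by omega, ← add_assoc, vertex_succ, vertex_succ, ih,
      hx d ih]

lemma edge_add_mul {n k : ℕ} (hv : vertex s x (k + n) = vertex s x k)
    (hx : ∀ d, vertex s x (k + d + n) = vertex s x (k + d) → x (k + d + n) = x (k + d))
    (d m : ℕ) : edge s x (k + d + n * m) = edge s x (k + d) ∧ x (k + d + n * m) = x (k + d) := by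
  have hv' := vertex_periodic hv hx
  induction m with
  | zero => simp
  | succ m ih =>
    have h0 := hx _ (hv' (d + n * m))
    have h1 := hv' (d + n * m)
    have h2 := hv' (d + n * m + 1)
    have e1 : k + d + n * (m + 1) = k + (d + n * m) + n := by ring
    have e2 : k + (d + n * m) + n + 1 = k + (d + n * m + 1) + n := by ring
    rw [← ih.1, ← ih.2, e1]
    refine ⟨?_, by rw [h0, add_assoc]⟩
    rw [edge, e2, h0, h1, h2, add_assoc k d, edge, ← add_assoc k _ 1]

/-- A closed walk given by an element of the commutator subgroup crosses each of its edges in both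
directions. -/
lemma exists_edge_eq_of_mem_commutator {n : ℕ}
    (hw : prefixProd x n ∈ ⁅(lift s).ker, (lift s).ker⁆) {i : ℕ} (hi : i < n) :
    ∃ j < n, edge s x j = edge s x i ∧ (x j).2 ≠ (x i).2 := by
  classical
  have key : ∀ k, unop (crossingHom s (edge s x i) (prefixProd x k)) (1, 0) = (vertex s x k,
      ∑ j ∈ Finset.range k, if edge s x j = edge s x i then (if (x j).2 then 1 else -1) else 0) := by
    intro k
    induction k with
    | zero => simp [prefixProd, vertex, ← one_eq_mk]
    | succ k ih =>
      have h := vertex_succ s x k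
      have hunop (e : α × Q) : unop (crossingHom s e (prefixProd x (k + 1))) (1, 0) =
          unop (crossingHom s e (mk [x k])) (unop (crossingHom s e (prefixProd x k)) (1, 0)) := by
        rw [prefixProd_succ, _root_.map_mul, unop_mul, Equiv.Perm.mul_apply]
      rw [hunop, ih, Finset.sum_range_succ]
      generalize edge s x i = e
      unfold edge
      generalize x k = p at *
      obtain ⟨b, _ | _⟩ := p
      · have h1 : mk [(b, false)] = (of b)⁻¹ := rfl
        have h2 : unop (crossingHom s e (mk [(b, false)])) = (crossingPerm s e b)⁻¹ := by
          rw [h1, _root_.map_inv]; simp [crossingHom]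
        rw [h1, _root_.map_inv, lift_apply_of] at h
        rw [h2, h]
        simp only [Equiv.Perm.inv_def, crossingPerm, Equiv.coe_fn_symm_mk]
        split_ifs <;> simp_all [sub_eq_add_neg]
      · have h1 : mk [(b, true)] = of b := rfl
        rw [h1, lift_apply_of] at h
        rw [h1, h]
        simp [crossingHom, crossingPerm]
  have hk := key n
  rw [(MonoidHom.mem_ker).1 (commutator_le_ker_crossingHom s (edge s x i) hw)] at hk
  have hsum := (Prod.ext_iff.1 hk).2
  by_contra! hcon
  -- Otherwise all crossings of this edge have the same sign, and their sum is not zero.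
  have hsame : ∀ j ∈ Finset.range n,
      (if edge s x j = edge s x i then (if (x j).2 then (1 : ℤ) else -1) else 0) =
      (if (x i).2 then 1 else -1) * if edge s x j = edge s x i then 1 else 0 := by
    intro j hj
    by_cases he : edge s x j = edge s x i
    · rw [if_pos he, if_pos he, hcon j (Finset.mem_range.1 hj) he, mul_one]
    · rw [if_neg he, if_neg he, mul_zero]
  rw [Finset.sum_congr rfl hsame, ← Finset.mul_sum, Finset.sum_boole] at hsum
  have hne : (Finset.range n).filter (fun j => edge s x j = edge s x i) ≠ ∅ :=
    Finset.ne_empty_of_mem (a := i) (by simp [hi])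
  rcases mul_eq_zero.1 hsum.symm with h | h
  · split_ifs at h
    all_goals simp at h
  · exact hne (by simpa using h)

end Walk

/-! ### The girth of the commutator subgroup -/

section Girth

variable [DecidableEq α] {Q : Type*} [Group Q] {s : α → Q} {g : ℕ}

/-- The bound for a cyclically reduced element of the commutator subgroup, given by one period of a
periodic walk without backtracking. -/
lemma three_mul_le_of_periodic (hg : ∀ w ∈ (lift s).ker, w ≠ 1 → g ≤ norm w)
    (hx : ∀ i, (x i).1 = (x (i + 1)).1 → (x i).2 = (x (i + 1)).2) {n : ℕ} (hn : 0 < n)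
    (hper : ∀ i, x (i + n) = x i)
    (hw : prefixProd x n ∈ ⁅(lift s).ker, (lift s).ker⁆) : 3 * g ≤ n := by
  classical
  set v := vertex s x with hvdef
  have hvn : v (0 + n) = v 0 := by
    have h0 : v 0 = 1 := by simp [hvdef, vertex, prefixProd, ← one_eq_mk]
    rw [h0, zero_add]
    exact Subgroup.commutator_le_right _ _ hw
  have hedge (i m : ℕ) : edge s x (i + n * m) = edge s x i ∧ x (i + n * m) = x i := by
    simpa using edge_add_mul hvn (fun d _ => hper _) i m
  have hback (i : ℕ) : ∃ j < n, edge s x j = edge s x i ∧ (x j).2 ≠ (x i).2 := by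
    have h := hedge (i % n) (i / n)
    rw [Nat.mod_add_div] at h
    rw [h.1, h.2]
    exact exists_edge_eq_of_mem_commutator hw (Nat.mod_lt _ hn)
  have hloop {i d : ℕ} (hd : 0 < d) (h : v i = v (i + d)) : g ≤ d := by
    have hr := isReduced_map_range' hx i d
    have hnorm : norm (mk ((List.range' i d).map x)) = d := by rw [hr.norm_mk]; simp
    rw [← hnorm]
    refine hg _ (vertex_eq_iff.1 h) fun h1 => ?_
    rw [h1, norm_one] at hnorm
    omega
  have hex : ∃ L, 0 < L ∧ ∃ k, v (k + L) = v k := ⟨n, hn, 0, hvn⟩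
  obtain ⟨L, ⟨hL, k₀, hk₀⟩, hLmin⟩ :
      ∃ L, (0 < L ∧ ∃ k, v (k + L) = v k) ∧ ∀ a b, a < b → v a = v b → a + L ≤ b := by
    refine ⟨Nat.find hex, Nat.find_spec hex, fun a b hab h => ?_⟩
    have := Nat.find_min' hex (m := b - a) ⟨by omega, a, by rw [Nat.add_sub_cancel' hab.le, h]⟩
    omega
  -- The walk leaves some shortest cycle right after going round it once.
  obtain ⟨k, hk, hxk⟩ : ∃ k, v (k + L) = v k ∧ x (k + L) ≠ x k := by
    by_contra! hcon
    obtain ⟨j, -, hje, hjs⟩ := hback k₀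
    have hle : k₀ ≤ j + n * k₀ := (Nat.le_mul_of_pos_left k₀ hn).trans (Nat.le_add_left _ _)
    obtain ⟨d, hd⟩ := Nat.exists_eq_add_of_le hle
    have h1 := hedge j k₀
    have h2 := edge_add_mul hk₀ (fun d => hcon (k₀ + d)) (d % L) (d / L)
    rw [add_assoc, Nat.mod_add_div, ← hd, h1.1, h1.2] at h2
    rcases Nat.eq_zero_or_pos (d % L) with hr | hr
    · rw [hr] at h2
      exact hjs (by rw [h2.2, add_zero])
    · refine edge_ne_edge hx (k := k₀) (m := k₀ + L) (fun a b ha hab hb h => ?_) le_rfl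
        (Nat.lt_add_of_pos_right hr) (Nat.add_lt_add_left (Nat.mod_lt d hL) k₀) (hje.symm.trans h2.1)
      have := hLmin a b hab h
      omega
  -- The walk goes on until it first meets a vertex visited since time `k`.
  have hex' : ∃ t, L < t ∧ ∃ u < t, v (k + t) = v (k + u) := by
    refine ⟨L + n, by omega, L, by omega, ?_⟩
    have := vertex_periodic hvn (fun d _ => hper _) (k + L)
    simpa only [zero_add, add_assoc] using this
  obtain ⟨t, ⟨hLt, u, hut, hu⟩, htmin⟩ : ∃ t, (L < t ∧ ∃ u < t, v (k + t) = v (k + u)) ∧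
      ∀ t' u', L < t' → t' < t → u' < t' → v (k + u') ≠ v (k + t') :=
    ⟨Nat.find hex', Nat.find_spec hex', fun t' u' h1 h2 h3 h4 =>
      Nat.find_min hex' h2 ⟨h1, u', h3, h4.symm⟩⟩
  have hne {a b : ℕ} (hka : k ≤ a) (hab : a < b) (hb : b < k + t) : edge s x a ≠ edge s x b := by
    refine edge_ne_edge hx (fun a b ha hab hb h => ?_) hka hab hb
    have hle := hLmin a b hab h
    obtain ⟨a, rfl⟩ := Nat.exists_eq_add_of_le ha
    obtain ⟨b, rfl⟩ := Nat.exists_eq_add_of_le (ha.trans hab.le)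
    have hbL : b ≤ L := by
      by_contra! hbL
      exact htmin b a hbL (by omega) (by omega) h
    obtain rfl : a = 0 := by omega
    obtain rfl : b = L := by omega
    exact ⟨rfl, hxk.symm⟩
  have hcard : 2 * t ≤ n := by
    have h1 : (Finset.range t).card ≤ ((Finset.range n).image (edge s x)).card := by
      refine Finset.card_le_card_of_injOn (fun i => edge s x (k + i)) (fun i _ => ?_) ?_
      · obtain ⟨j, hj, hje, -⟩ := hback (k + i)
        exact Finset.mem_coe.2 (Finset.mem_image.2 ⟨j, Finset.mem_range.2 hj, hje⟩)
      · intro a ha b hb hab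
        simp only [Finset.coe_range, Set.mem_Iio] at ha hb
        rcases lt_trichotomy a b with h | h | h
        · exact (hne (by omega) (by omega) (by omega) hab).elim
        · exact h
        · exact (hne (by omega) (by omega) (by omega) hab.symm).elim
    have h2 := Finset.mul_card_image_le_card (f := edge s x) (Finset.range n) 2 (by
      intro e he
      obtain ⟨i, hi, rfl⟩ := Finset.mem_image.1 he
      obtain ⟨j, hj, hje, hjs⟩ := hback i
      refine Finset.one_lt_card.2 ⟨i, by simpa using hi, j, by simpa [hj] using hje, ?_⟩
      rintro rfl
      exact hjs rfl)
    simp only [Finset.card_range] at h1 h2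
    omega
  have g1 : g ≤ L := hloop hL hk.symm
  have g2 : g ≤ t - u := hloop (i := k + u) (by omega) (by
    rw [← hu]
    congr 1
    omega)
  rcases Nat.lt_or_ge u L with huL | huL
  · -- The third closed walk of the theta graph: along the new arc, and back to time `k`.
    have g3 : g ≤ (t - L) + u := by
      have r1 := isReduced_map_range' hx (k + L) (t - L)
      have r2 := isReduced_map_range' hx k u
      have hle : norm (mk ((List.range' (k + L) (t - L)).map x) *
          (mk ((List.range' k u).map x))⁻¹) ≤ (t - L) + u := by
        refine (norm_mul_le _ _).trans ?_
        rw [norm_inv_eq, r1.norm_mk, r2.norm_mk]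
        simp
      refine (hg _ ?_ fun h => ?_).trans hle
      · have e1 : v (k + t) = v (k + L) * lift s (mk ((List.range' (k + L) (t - L)).map x)) := by
          rw [hvdef, vertex, vertex, ← _root_.map_mul, ← prefixProd_add]
          congr 2
          omega
        have e2 : v (k + u) = v k * lift s (mk ((List.range' k u).map x)) := by
          rw [hvdef, vertex, vertex, ← _root_.map_mul, ← prefixProd_add]
        rw [MonoidHom.mem_ker, _root_.map_mul, _root_.map_inv, mul_inv_eq_one]
        rw [hu, e2, hk] at e1
        exact (mul_left_cancel e1).symm
      · have hl := r1.mk_injOn r2 (mul_inv_eq_one.1 h)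
        have hlen := congrArg List.length hl
        simp only [List.length_map, List.length_range'] at hlen
        rw [← hlen, show t - L = (t - L - 1) + 1 by omega, List.range'_succ, List.range'_succ,
          List.map_cons, List.map_cons] at hl
        exact hxk (List.cons.inj hl).1
    omega
  · omega

/-- If every nontrivial element of a normal subgroup has length at least `g`, then every nontrivial
element of its commutator subgroup has length at least `3 * g`. -/
theorem three_mul_le_norm_of_mem_commutator {Λ : Subgroup (FreeGroup α)} [Λ.Normal]
    (hg : ∀ w ∈ Λ, w ≠ 1 → g ≤ norm w) {w : FreeGroup α} (hw : w ∈ ⁅Λ, Λ⁆) (hw1 : w ≠ 1) :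
    3 * g ≤ norm w := by
  have hker : (lift fun a => (of a : FreeGroup α ⧸ Λ)).ker = Λ := by
    have : (lift fun a => (of a : FreeGroup α ⧸ Λ)) = QuotientGroup.mk' Λ := by
      ext a
      simp
    rw [this, QuotientGroup.ker_mk']
  set c := reduceCyclically.conjugator w.toWord
  set l := reduceCyclically w.toWord
  have hl : c ++ l ++ invRev c = w.toWord :=
    reduceCyclically.conj_conjugator_reduceCyclically w.toWord
  have hconj : mk c * mk l * (mk c)⁻¹ = w := by
    rw [inv_mk, mul_mk, mul_mk, hl, mk_toWord]
  have hlw : mk l ∈ ⁅Λ, Λ⁆ := by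
    have := (inferInstance : (⁅Λ, Λ⁆).Normal).conj_mem w hw (mk c)⁻¹
    have e : (mk c)⁻¹ * w * (mk c)⁻¹⁻¹ = mk l := by
      rw [← hconj]
      group
    rwa [e] at this
  have hne : l ≠ [] := by
    intro h
    rw [h, ← one_eq_mk] at hconj
    exact hw1 (by rw [← hconj, mul_one, mul_inv_cancel])
  obtain ⟨x, hper, hx, hxl⟩ :=
    (reduceCyclically.isCyclicallyReduced (isReduced_toWord (x := w))).exists_periodic hne
  rw [← hker] at hg
  have := three_mul_le_of_periodic hg hx (List.length_pos_iff.2 hne) hper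
    (by rw [hker, hxl]; exact hlw)
  refine this.trans ?_
  rw [norm, ← hl]
  simp only [List.length_append]
  omega

end Girth

end FreeGroup

theorem theorem4p1 (Λ : Subgroup (FreeGroup (Fin 2))) (hΛ : Λ.Normal) :
    3 * freeGirth Λ ≤ freeGirth ⁅Λ, Λ⁆ := by
  have hle {w : FreeGroup (Fin 2)} (hw : w ∈ Λ) (hw1 : w ≠ 1) : freeGirth Λ ≤ w.norm :=
    sInf_le ⟨w, ⟨hw, hw1⟩, rfl⟩
  refine le_sInf ?_
  rintro _ ⟨w, ⟨hw, hw1⟩, rfl⟩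
  have hfin := hle (Subgroup.commutator_le_right _ _ hw) hw1
  obtain ⟨g, hg⟩ := ENat.ne_top_iff_exists.1 (ne_top_of_le_ne_top (ENat.natCast_ne_top _) hfin)
  rw [← hg] at hle ⊢
  have h := FreeGroup.three_mul_le_norm_of_mem_commutator (g := g)
    (fun w hw hw1 => by exact_mod_cast hle hw hw1) hw hw1
  change 3 * (g : ℕ∞) ≤ (w.norm : ℕ∞)
  exact_mod_cast h
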